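/- Let $\Omega\subset\mathbb R^d$ be bounded and convex, and let $X$ be a random vector with values in $\Omega$ whose law has a Lebesgue density that is bounded above and bounded below away from zero on $\Omega$. Let $\nu,\ell>0$ be arbitrary, let $$\Psi(x)=\frac{1}{\mathsf\Gamma(\nu)2^{\nu-1}}\Bigl(\frac{\sqrt{2\nu}\|x\|}{\ell}\Bigr)^{\nu}\mathsf K_\nu\Bigl(\frac{\sqrt{2\nu}\|x\|}{\ell}\Bigr)\quad(x\ne 0),\qquad \Psi(0)=1,$$ where $\mathsf\Gamma(\cdot)$ is the gamma function and $\mathsf K_\nu$ is the modified Bessel function of the second kind, and let $\mathscr N_\Psi(\Omega)$ be the reproducing kernel Hilbert space of the Matérn kernel $(x,\tilde x)\mapsto\Psi(x-\tilde x)$ on $\Omega$. Let $f\in\mathscr N_\Psi(\Omega)$ and $\theta=\mathbb E[f(X)]$. For $n,m\ge 1$, let $x_1,\dots,x_n$ be i.i.d. copies of $X$ and $y_{ij}=f(x_i)+\epsilon_{ij}$ ($1\le i\le n$, $1\le j\le m$), where, given $x_1,\dots,x_n$, the noise terms $\epsilon_{ij}$ are independent, have mean zero and are sub-Gaussian with a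 variance proxy $\sigma^2$ that does not depend on $n,m,i,j$ (that is, $\mathbb E[e^{s\epsilon_{ij}}\mid x_1,\dots,x_n]\le e^{\sigma^2s^2/2}$ for all $s\in\mathbb R$), and $\epsilon_{i1},\dots,\epsilon_{im}$ are identically distributed for each $i$. Put $\bar y_i=m^{-1}\sum_{j=1}^m y_{ij}$ and, for $\lambda>0$, $$\hat f=\operatorname*{arg\,min}_{g\in\mathscr N_\Psi(\Omega)}\Bigl(\frac1n\sum_{i=1}^n(\bar y_i-g(x_i))^2+\lambda\|g\|^2_{\mathscr N_\Psi(\Omega)}\Bigr),\qquad \hat\theta_{n,m}=\frac1n\sum_{i=1}^n\hat f(x_i).$$ Let the simulation budget be $\Gamma=nm\to\infty$. If $n\asymp\Gamma$, $m\asymp1$ and $\lambda\asymp\Gamma^{-1}$, then $f(X)$ is integrable and $$|\hat\theta_{n,m}-\theta|=O_{\mathbb P}(\Gamma^{-1/2}),$$ that is, for every $\varepsilon>0$ there is $C>0$ such that $\mathbb P(|\hat\theta_{n,m}-\theta|>C\,\Gamma^{-1/2})<\varepsilon$ for all sufficiently large $\Gamma$. Here $a\asymp b$ means that $C'\le a/b\le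 C''$ for some constants $C',C''>0$ and all sufficiently large $\Gamma$. -/

import Mathlib

open MeasureTheory ProbabilityTheory Filter Asymptotics
open scoped NNReal ENNReal RealInnerProductSpace

namespace NestedKRR

noncomputable section

/-- The modified Bessel function of the second kind `K_ν(z)`, for real `z > 0`. -/
def besselK (ν z : ℝ) : ℝ :=
  ∫ t in Set.Ioi (0 : ℝ), Real.exp (-z * Real.cosh t) * Real.cosh (ν * t)

/-- The Matérn function `Ψ`; at the origin it takes its limit value `1`. -/
def matern {d : ℕ} (ν ℓ : ℝ) (x : EuclideanSpace ℝ (Fin d)) : ℝ :=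
  if x = 0 then 1
  else 1 / (Real.Gamma ν * 2 ^ (ν - 1)) * (Real.sqrt (2 * ν) * ‖x‖ / ℓ) ^ ν *
    besselK ν (Real.sqrt (2 * ν) * ‖x‖ / ℓ)

theorem integrableOn_mixture {ν : ℝ} (hν : 0 < ν) (z : ℝ) :
    IntegrableOn (fun u : ℝ => u ^ (ν - 1) * Real.exp (-u) * Real.exp (-(z ^ 2 / (4 * u))))
      (Set.Ioi 0) := by
  have h := Real.GammaIntegral_convergent hν
  refine Integrable.mono' h (by fun_prop) ?_
  refine (ae_restrict_iff' measurableSet_Ioi).2 (Eventually.of_forall fun u hu => ?_)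
  have hu : 0 < u := hu
  have h1 : 0 ≤ u ^ (ν - 1) := Real.rpow_nonneg hu.le _
  rw [Real.norm_of_nonneg (by positivity), mul_comm (Real.exp (-u)) (u ^ (ν - 1))]
  refine mul_le_of_le_one_right (by positivity) (Real.exp_le_one_iff.2 ?_)
  have : 0 ≤ z ^ 2 / (4 * u) := by positivity
  linarith

theorem rpow_mul_besselK {ν z : ℝ} (hν : 0 < ν) (hz : 0 < z) :
    z ^ ν * besselK ν z = 2 ^ (ν - 1) * ∫ u in Set.Ioi (0 : ℝ),
      u ^ (ν - 1) * Real.exp (-u) * Real.exp (-(z ^ 2 / (4 * u))) := by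
  set G : ℝ → ℝ := fun u => u ^ (ν - 1) * Real.exp (-u) * Real.exp (-(z ^ 2 / (4 * u))) with hG
  set f : ℝ → ℝ := fun t => z / 2 * Real.exp t with hf
  have himg : f '' Set.univ = Set.Ioi 0 := by
    ext u
    simp only [Set.image_univ, Set.mem_range, Set.mem_Ioi, hf]
    constructor
    · rintro ⟨t, rfl⟩; positivity
    · intro hu
      refine ⟨Real.log (u / (z / 2)), ?_⟩
      rw [Real.exp_log (by positivity)]
      field_simp
  have hder : ∀ t ∈ Set.univ, HasDerivWithinAt f (f t) Set.univ t := fun t _ =>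
    ((Real.hasDerivAt_exp t).const_mul (z / 2)).hasDerivWithinAt
  have hinj : Set.InjOn f Set.univ := by
    intro s _ t _ h
    have : Real.exp s = Real.exp t := by
      have hz2 : z / 2 ≠ 0 := by positivity
      exact mul_left_cancel₀ hz2 h
    exact Real.exp_injective this
  have hpt : ∀ t, |f t| • G (f t)
      = (z / 2) ^ ν * (Real.exp (-z * Real.cosh t) * Real.exp (ν * t)) := by
    intro t
    have hft : 0 < f t := by simp only [hf]; positivity
    have e1 : f t * f t ^ (ν - 1) = (z / 2) ^ ν * Real.exp (ν * t) := by
      rw [← Real.rpow_one_add' hft.le (by linarith)]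
      simp only [hf]
      rw [Real.mul_rpow (by positivity) (by positivity), ← Real.exp_mul]
      ring_nf
    have e2 : Real.exp (-f t) * Real.exp (-(z ^ 2 / (4 * f t))) = Real.exp (-z * Real.cosh t) := by
      rw [← Real.exp_add]
      congr 1
      simp only [hf, Real.cosh_eq, Real.exp_neg]
      field_simp
      ring
    rw [abs_of_pos hft, smul_eq_mul]
    simp only [hG]
    rw [← e2]
    linear_combination (Real.exp (-f t) * Real.exp (-(z ^ 2 / (4 * f t)))) * e1
  have hint : Integrable (fun t => Real.exp (-z * Real.cosh t) * Real.exp (ν * t)) := by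
    have h := (integrableOn_image_iff_integrableOn_abs_deriv_smul MeasurableSet.univ hder hinj G).1
      (by rw [himg]; exact integrableOn_mixture hν z)
    rw [integrableOn_univ] at h
    simp_rw [hpt] at h
    have hc : (z / 2) ^ ν ≠ 0 := by positivity
    exact (integrable_const_mul_iff (IsUnit.mk0 _ hc) _).1 h
  have hval : ∫ u in Set.Ioi (0 : ℝ), G u
      = (z / 2) ^ ν * ∫ t, Real.exp (-z * Real.cosh t) * Real.exp (ν * t) := by
    rw [← himg, integral_image_eq_integral_abs_deriv_smul MeasurableSet.univ hder hinj G,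
      setIntegral_univ, ← integral_const_mul]
    exact integral_congr_ae (Eventually.of_forall hpt)
  have hint' : Integrable (fun t => Real.exp (-z * Real.cosh t) * Real.exp (-(ν * t))) := by
    simpa [Real.cosh_neg] using hint.comp_neg
  have hval' : ∫ t, Real.exp (-z * Real.cosh t) * Real.exp (-(ν * t))
      = ∫ t, Real.exp (-z * Real.cosh t) * Real.exp (ν * t) := by
    rw [← integral_neg_eq_self (fun t => Real.exp (-z * Real.cosh t) * Real.exp (ν * t))]
    simp [Real.cosh_neg]
  have hK : 2 * besselK ν z = ∫ t, Real.exp (-z * Real.cosh t) * Real.exp (ν * t) := by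
    have h := integral_comp_abs (f := fun t => Real.exp (-z * Real.cosh t) * Real.cosh (ν * t))
    have h2 : ∀ t : ℝ, Real.exp (-z * Real.cosh |t|) * Real.cosh (ν * |t|)
        = (1 / 2) * (Real.exp (-z * Real.cosh t) * Real.exp (ν * t))
          + (1 / 2) * (Real.exp (-z * Real.cosh t) * Real.exp (-(ν * t))) := by
      intro t
      have : Real.cosh (ν * |t|) = Real.cosh (ν * t) := by
        rw [← Real.cosh_abs (ν * |t|), ← Real.cosh_abs (ν * t), abs_mul, abs_mul, abs_abs]
      rw [Real.cosh_abs, this, Real.cosh_eq (ν * t)]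
      ring
    unfold besselK
    rw [← h]
    simp_rw [h2]
    rw [integral_add (hint.const_mul _) (hint'.const_mul _), integral_const_mul,
      integral_const_mul, hval']
    ring
  have h3 : z ^ ν = 2 ^ ν * (z / 2) ^ ν := by
    rw [← Real.mul_rpow (by norm_num) (by positivity)]
    congr 1
    ring
  have h4 : (2 : ℝ) ^ (ν - 1) = 2 ^ ν / 2 := by
    rw [Real.rpow_sub_one (by norm_num)]
  rw [hval, ← hK, h3, h4]
  ring

theorem matern_eq_mixture {d : ℕ} {ν ℓ : ℝ} (hν : 0 < ν) (hℓ : 0 < ℓ)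
    (x : EuclideanSpace ℝ (Fin d)) :
    matern ν ℓ x = (Real.Gamma ν)⁻¹ * ∫ u in Set.Ioi (0 : ℝ),
      u ^ (ν - 1) * Real.exp (-u) *
        Real.exp (-((Real.sqrt (2 * ν) * ‖x‖ / ℓ) ^ 2 / (4 * u))) := by
  have hΓ : 0 < Real.Gamma ν := Real.Gamma_pos_of_pos hν
  unfold matern
  split_ifs with hx
  · subst hx
    have : ∀ u : ℝ, u ^ (ν - 1) * Real.exp (-u) = Real.exp (-u) * u ^ (ν - 1) :=
      fun u => mul_comm _ _
    simp only [norm_zero, mul_zero, zero_div, ne_eq, OfNat.ofNat_ne_zero, not_false_eq_true,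
      zero_pow, neg_zero, Real.exp_zero, mul_one, this]
    rw [← Real.Gamma_eq_integral hν, inv_mul_cancel₀ hΓ.ne']
  · have hz : 0 < Real.sqrt (2 * ν) * ‖x‖ / ℓ := by
      have := norm_pos_iff.2 hx
      positivity
    rw [mul_assoc, rpow_mul_besselK hν hz, ← mul_assoc]
    congr 1
    field_simp

theorem gaussian_sum_nonneg {d : ℕ} {ι : Type*} (s : Finset ι) (w : ι → ℝ)
    (x : ι → EuclideanSpace ℝ (Fin d)) :
    0 ≤ ∑ i ∈ s, ∑ j ∈ s, w i * w j * Real.exp (-(‖x i - x j‖ ^ 2 / 2)) := by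
  set γ := stdGaussian (EuclideanSpace ℝ (Fin d))
  have hcos : ∀ t : EuclideanSpace ℝ (Fin d),
      Real.exp (-(‖t‖ ^ 2 / 2)) = ∫ y, Real.cos ⟪y, t⟫ ∂γ := by
    intro t
    have h := congrArg Complex.re (charFun_stdGaussian t)
    have hi : Integrable (fun y : EuclideanSpace ℝ (Fin d) =>
        Complex.exp (⟪y, t⟫ * Complex.I)) γ := by
      refine Integrable.of_bound (by fun_prop) 1 (Eventually.of_forall fun y => ?_)
      rw [Complex.norm_exp_ofReal_mul_I]
    rw [charFun_apply] at h
    have h' := integral_re hi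
    simp only [RCLike.re_to_complex] at h'
    rw [← h'] at h
    simp only [Complex.exp_ofReal_mul_I_re] at h
    rw [h]
    have : (-(‖t‖ : ℂ) ^ 2 / 2) = ((-(‖t‖ ^ 2 / 2) : ℝ) : ℂ) := by push_cast; ring
    rw [this, Complex.exp_ofReal_re]
  simp_rw [hcos]
  have hint : ∀ i j, Integrable (fun y => w i * w j * Real.cos ⟪y, x i - x j⟫) γ := by
    intro i j
    refine Integrable.const_mul (Integrable.of_bound (by fun_prop) 1
      (Eventually.of_forall fun y => ?_)) _
    exact Real.abs_cos_le_one _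
  have : ∑ i ∈ s, ∑ j ∈ s, w i * w j * ∫ y, Real.cos ⟪y, x i - x j⟫ ∂γ
      = ∫ y, (∑ i ∈ s, w i * Real.cos ⟪y, x i⟫) ^ 2 + (∑ i ∈ s, w i * Real.sin ⟪y, x i⟫) ^ 2 ∂γ := by
    simp_rw [← integral_const_mul]
    rw [Finset.sum_congr rfl fun i _ => (integral_finsetSum s fun j _ => hint i j).symm,
      ← integral_finsetSum s fun i _ => integrable_finsetSum s fun j _ => hint i j]
    congr 1
    ext y
    rw [sq, sq, Finset.sum_mul_sum, Finset.sum_mul_sum, ← Finset.sum_add_distrib]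
    refine Finset.sum_congr rfl fun i _ => ?_
    rw [← Finset.sum_add_distrib]
    refine Finset.sum_congr rfl fun j _ => ?_
    rw [inner_sub_right, Real.cos_sub]
    ring
  rw [this]
  exact integral_nonneg fun y => by positivity

theorem matern_sum_nonneg {d : ℕ} {ν ℓ : ℝ} (hν : 0 < ν) (hℓ : 0 < ℓ) {ι : Type*}
    (s : Finset ι) (w : ι → ℝ) (x : ι → EuclideanSpace ℝ (Fin d)) :
    0 ≤ ∑ i ∈ s, ∑ j ∈ s, w i * w j * matern ν ℓ (x i - x j) := by
  set G : EuclideanSpace ℝ (Fin d) → ℝ → ℝ := fun v u => u ^ (ν - 1) * Real.exp (-u) *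
        Real.exp (-((Real.sqrt (2 * ν) * ‖v‖ / ℓ) ^ 2 / (4 * u))) with hG
  have hint : ∀ i j, IntegrableOn (fun u => w i * w j * G (x i - x j) u) (Set.Ioi 0) :=
    fun i j => (integrableOn_mixture hν _).const_mul _
  have : ∑ i ∈ s, ∑ j ∈ s, w i * w j * matern ν ℓ (x i - x j)
      = (Real.Gamma ν)⁻¹ * ∫ u in Set.Ioi (0 : ℝ),
        ∑ i ∈ s, ∑ j ∈ s, w i * w j * G (x i - x j) u := by
    rw [integral_finsetSum s fun i _ => integrable_finsetSum s fun j _ => hint i j,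
      Finset.mul_sum]
    refine Finset.sum_congr rfl fun i _ => ?_
    rw [integral_finsetSum s fun j _ => hint i j, Finset.mul_sum]
    refine Finset.sum_congr rfl fun j _ => ?_
    rw [matern_eq_mixture hν hℓ, integral_const_mul]
    ring
  rw [this]
  refine mul_nonneg (inv_nonneg.2 (Real.Gamma_pos_of_pos hν).le)
    (setIntegral_nonneg measurableSet_Ioi fun u hu => ?_)
  have hu : 0 < u := hu
  set c : ℝ := Real.sqrt (2 * ν) / ℓ * Real.sqrt (1 / (2 * u)) with hc
  have h := gaussian_sum_nonneg s w fun i => c • x i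
  have e : ∀ i j, w i * w j * G (x i - x j) u = u ^ (ν - 1) * Real.exp (-u) *
      (w i * w j * Real.exp (-(‖c • x i - c • x j‖ ^ 2 / 2))) := by
    intro i j
    have : (Real.sqrt (2 * ν) * ‖x i - x j‖ / ℓ) ^ 2 / (4 * u)
        = ‖c • x i - c • x j‖ ^ 2 / 2 := by
      rw [← smul_sub, norm_smul, mul_pow, Real.norm_eq_abs, sq_abs, hc, mul_pow,
        Real.sq_sqrt (by positivity)]
      field_simp
      ring
    simp only [hG]
    rw [this]
    ring
  simp_rw [e, ← Finset.mul_sum]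
  exact mul_nonneg (mul_nonneg (Real.rpow_nonneg hu.le _) (Real.exp_pos _).le) h

/-- The Matérn kernel `k(x, y) = Ψ(x - y)` on `D`, as a matrix of (scalar) operators on `ℝ`. -/
def maternMatrix {d : ℕ} (D : Set (EuclideanSpace ℝ (Fin d))) (ν ℓ : ℝ) :
    Matrix D D (ℝ →L[ℝ] ℝ) :=
  .of fun x y => matern ν ℓ (x.1 - y.1) • 1

theorem matern_neg {d : ℕ} (ν ℓ : ℝ) (x : EuclideanSpace ℝ (Fin d)) :
    matern ν ℓ (-x) = matern ν ℓ x := by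
  simp [matern]

instance posSemidef_maternMatrix {d : ℕ} (D : Set (EuclideanSpace ℝ (Fin d))) (ν ℓ : ℝ)
    [hν : Fact (0 < ν)] [hℓ : Fact (0 < ℓ)] : Fact (maternMatrix D ν ℓ).PosSemidef := by
  have hiff := (RKHS.posSemidef_tfae (K := maternMatrix D ν ℓ)).out 0 2
  refine ⟨hiff.2 (And.intro ?_ fun w => ?_)⟩
  · ext x y
    simp [maternMatrix, ← matern_neg ν ℓ (y.1 - x.1)]
  · have h := matern_sum_nonneg hν.out hℓ.out w.support w (fun x : D => x.1)
    simp only [Finsupp.sum, maternMatrix, Matrix.of_apply, RCLike.re_to_real]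
    refine h.trans_eq (Finset.sum_congr rfl fun i _ => Finset.sum_congr rfl fun j _ => ?_)
    rw [← matern_neg]
    simp [mul_comm, mul_left_comm]

/-- The reproducing kernel Hilbert space of the Matérn kernel on `D`: the completion of the span of
the functions `k(·, x)`, `x ∈ D`, for the inner product given by `⟨k(·, x), k(·, y)⟩ = k(x, y)`. -/
abbrev MaternRKHS {d : ℕ} (D : Set (EuclideanSpace ℝ (Fin d))) (ν ℓ : ℝ)
    [Fact (0 < ν)] [Fact (0 < ℓ)] : Type :=
  RKHS.OfKernel (maternMatrix D ν ℓ)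

/-- The objective of kernel ridge regression,
`g ↦ n⁻¹ ∑ᵢ (yᵢ - g(xᵢ))² + λ ‖g‖²`, on a reproducing kernel Hilbert space `H`. -/
def krrObjective {H X : Type*} [NormedAddCommGroup H] [InnerProductSpace ℝ H] [RKHS ℝ H X ℝ]
    (lam : ℝ) {n : ℕ} (x : Fin n → X) (y : Fin n → ℝ) (g : H) : ℝ :=
  (n : ℝ)⁻¹ * ∑ i, (y i - g (x i)) ^ 2 + lam * ‖g‖ ^ 2

theorem existsUnique_krr {H X : Type*} [NormedAddCommGroup H] [InnerProductSpace ℝ H]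
    [CompleteSpace H] [RKHS ℝ H X ℝ] {lam : ℝ} (hlam : 0 < lam) {n : ℕ} (x : Fin n → X)
    (y : Fin n → ℝ) : ∃! g : H, ∀ h : H, krrObjective lam x y g ≤ krrObjective lam x y h := by
  set k : Fin n → H := fun i => RKHS.kerFun H (x i) (1 : ℝ) with hk
  have hev : ∀ i (g : H), ⟪k i, g⟫ = g (x i) := by
    intro i g
    simp [hk]
  let I : H →L[ℝ] H →L[ℝ] ℝ := innerSL ℝ
  let B : H →L[ℝ] H →L[ℝ] ℝ :=
    lam • I + (n : ℝ)⁻¹ • ∑ i, (innerSL ℝ (k i)).smulRight (innerSL ℝ (k i))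
  have hB : ∀ g h : H, B g h = lam * ⟪g, h⟫ + (n : ℝ)⁻¹ * ∑ i, g (x i) * h (x i) := by
    intro g h
    simp only [B, I, ← hev]
    simp
    exact Or.inl rfl
  have hco : IsCoercive B := by
    refine ⟨lam, hlam, fun g => ?_⟩
    rw [hB, real_inner_self_eq_norm_mul_norm]
    have : 0 ≤ (n : ℝ)⁻¹ * ∑ i, g (x i) * g (x i) :=
      mul_nonneg (by positivity) (Finset.sum_nonneg fun i _ => mul_self_nonneg _)
    linarith
  set g := hco.continuousLinearEquivOfBilin.symm ((n : ℝ)⁻¹ • ∑ i, y i • k i) with hg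
  have hnormal : ∀ h : H, B g h = (n : ℝ)⁻¹ * ∑ i, y i * h (x i) := by
    intro h
    rw [← hco.continuousLinearEquivOfBilin_apply, hg]
    simp [inner_smul_left, sum_inner, hev]
  have key : ∀ h : H, krrObjective lam x y h
      = krrObjective lam x y g + B (h - g) (h - g) := by
    intro h
    have h1 := hnormal (h - g)
    rw [hB] at h1
    rw [hB]
    have e : ‖h‖ ^ 2 = ‖g‖ ^ 2 + 2 * ⟪g, h - g⟫ + ⟪h - g, h - g⟫ := by
      rw [real_inner_self_eq_norm_sq, ← norm_add_sq_real, add_sub_cancel]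
    have e2 : ∑ i, (y i - h (x i)) ^ 2 = ∑ i, (y i - g (x i)) ^ 2
        - 2 * ∑ i, y i * (h - g) (x i) + 2 * ∑ i, g (x i) * (h - g) (x i)
        + ∑ i, (h - g) (x i) * (h - g) (x i) := by
      simp only [Finset.mul_sum, ← Finset.sum_sub_distrib, ← Finset.sum_add_distrib]
      refine Finset.sum_congr rfl fun i _ => ?_
      simp only [RKHS.coe_sub, Pi.sub_apply]
      ring
    unfold krrObjective
    rw [e, e2]
    linear_combination 2 * h1
  have hpos : ∀ v : H, lam * ‖v‖ ^ 2 ≤ B v v := by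
    intro v
    rw [hB, real_inner_self_eq_norm_sq]
    have : 0 ≤ (n : ℝ)⁻¹ * ∑ i, v (x i) * v (x i) :=
      mul_nonneg (by positivity) (Finset.sum_nonneg fun i _ => mul_self_nonneg _)
    linarith
  refine ⟨g, fun h => ?_, fun h hh => ?_⟩
  · rw [key h]
    have := hpos (h - g)
    have : 0 ≤ lam * ‖h - g‖ ^ 2 := by positivity
    linarith
  · have h1 := hh g
    rw [key h] at h1
    have h2 := hpos (h - g)
    have h3 : lam * ‖h - g‖ ^ 2 ≤ 0 := by linarith
    have h4 : ‖h - g‖ ^ 2 ≤ 0 := by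
      by_contra hc
      push Not at hc
      have := mul_pos hlam hc
      linarith
    have h5 : ‖h - g‖ = 0 := by
      have := sq_nonneg ‖h - g‖
      exact pow_eq_zero_iff (two_ne_zero) |>.1 (le_antisymm h4 this)
    exact sub_eq_zero.1 (norm_eq_zero.1 h5)


/-- The kernel ridge regression estimator: the unique minimizer of the objective over `H`. -/
def krrEstimator (H : Type*) {X : Type*} [NormedAddCommGroup H] [InnerProductSpace ℝ H]
    [CompleteSpace H] [RKHS ℝ H X ℝ] {lam : ℝ} (hlam : 0 < lam) {n : ℕ} (x : Fin n → X)
    (y : Fin n → ℝ) : H :=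
  (existsUnique_krr (H := H) hlam x y).choose

/-- The averages of the inner-level samples, `ȳᵢ = m⁻¹ ∑ⱼ yᵢⱼ`. -/
def innerMean {n m : ℕ} (y : Fin n → Fin m → ℝ) (i : Fin n) : ℝ :=
  (m : ℝ)⁻¹ * ∑ j, y i j

/-- The KRR-driven nested simulation estimator of an expectation, `n⁻¹ ∑ᵢ f̂(xᵢ)`, where `f̂` is the
kernel ridge regression estimator from the data `(xᵢ, ȳᵢ)`. -/
def krrNestedMean (H : Type*) {X : Type*} [NormedAddCommGroup H] [InnerProductSpace ℝ H]
    [CompleteSpace H] [RKHS ℝ H X ℝ] {lam : ℝ} (hlam : 0 < lam) {n m : ℕ} (x : Fin n → X)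
    (y : Fin n → Fin m → ℝ) : ℝ :=
  (n : ℝ)⁻¹ * ∑ i, krrEstimator H hlam x (innerMean y) (x i)

/-- The probability measure `μ` on `D` has a density with respect to Lebesgue measure on `D` that is
bounded above and bounded below away from zero on `D`. -/
def HasDensityBoundedAboveBelow {d : ℕ} {D : Set (EuclideanSpace ℝ (Fin d))}
    (μ : Measure D) : Prop :=
  ∃ p : EuclideanSpace ℝ (Fin d) → ℝ, Measurable p ∧
    (∃ a b : ℝ, 0 < a ∧ ∀ z ∈ D, a ≤ p z ∧ p z ≤ b) ∧
    μ.map Subtype.val = (volume.restrict D).withDensity fun z => ENNReal.ofReal (p z)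

/-- The σ-algebra generated by the scenarios `x₁, …, xₙ`. -/
abbrev scenarioSigma {S X : Type*} [MeasurableSpace X] {n : ℕ} (x : Fin n → S → X) :
    MeasurableSpace S :=
  MeasurableSpace.comap (fun ω i => x i ω) MeasurableSpace.pi

theorem scenarioSigma_le {S X : Type*} [mS : MeasurableSpace S] [MeasurableSpace X] {n : ℕ}
    {x : Fin n → S → X} (hx : ∀ i, Measurable (x i)) : scenarioSigma x ≤ mS :=
  (measurable_pi_lambda _ hx).comap_le

/-- Scenarios and simulation noise of a nested simulation with `n` outer-level scenarios and `m`
inner-level samples for each of them. The scenarios are i.i.d. copies of `X`, whose law is `μX`.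
Given the scenarios, the noise terms are independent, have mean zero, and are sub-Gaussian with
variance proxy `σ²`, and those that belong to the same scenario are identically distributed. -/
structure IsNestedSample {S X : Type*} [MeasurableSpace S] [StandardBorelSpace S]
    [MeasurableSpace X] (P : Measure S) [IsProbabilityMeasure P] (μX : Measure X) (σ : ℝ≥0)
    {n m : ℕ} (x : Fin n → S → X) (ε : Fin n → Fin m → S → ℝ) : Prop where
  measurable_scenario : ∀ i, Measurable (x i)
  map_scenario : ∀ i, P.map (x i) = μX
  indep_scenario : iIndepFun x P
  measurable_noise : ∀ i j, Measurable (ε i j)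
  mean_noise : ∀ i j, P[ε i j | scenarioSigma x] =ᵐ[P] 0
  subgaussian_noise : ∀ i j, HasCondSubgaussianMGF (scenarioSigma x)
    (scenarioSigma_le measurable_scenario) (ε i j) (σ ^ 2) P
  indep_noise : iCondIndepFun (scenarioSigma x) (scenarioSigma_le measurable_scenario)
    (fun q : Fin n × Fin m => ε q.1 q.2) P
  ident_noise : ∀ i j j', ∀ᵐ ω ∂P, (condExpKernel P (scenarioSigma x) ω).map (ε i j)
    = (condExpKernel P (scenarioSigma x) ω).map (ε i j')

/-- `Z t = O_P(b t)` as `t → ∞`, for random variables `Z t` on probability spaces `(S t, P t)`. -/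
def IsBigOInProb {S : ℕ → Type*} [∀ t, MeasurableSpace (S t)] (P : ∀ t, Measure (S t))
    (Z : ∀ t, S t → ℝ) (b : ℕ → ℝ) : Prop :=
  ∀ δ : ℝ, 0 < δ → ∃ C : ℝ, 0 < C ∧ ∀ᶠ t in atTop, (P t).real {ω | C * b t < Z t ω} < δ

end

end NestedKRR

open NestedKRR

/-! Averaging the fitted values is a linear functional of the responses. Ridge smoothing is
self-adjoint at the design points, so that functional has weights `krrWeight`, the fit to the
constant response 1 (`sum_krrEstimator_eq`), and these depend on the scenarios only. The error then
splits into three terms, with no need for a convergence rate of the regression function.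

Bias: by the normal equation it is `-λ⟪g, f⟫`, with `g` the fit to 1. Comparing `g` with the zero
function gives `λ‖g‖² ≤ 1`, so the bias is at most `√λ ‖f‖` (`abs_bias_le`). Noise: given the
scenarios the noise is centred and uncorrelated, and the squared weights sum to at most `n`
(`sum_krrWeight_sq_le`), so the second moment is of order `1/(nm)`. Sampling: the kernel is 1 on the
diagonal, so `|f| ≤ ‖f‖` and the empirical mean of `f` has variance at most `‖f‖²/n`.

Chebyshev's inequality handles the two random terms; all three have order `Γ^(-1/2)`. -/

namespace NestedKRR

noncomputable section

/-! ### Ridge regression at fixed design points. -/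

section Deterministic

variable {H X : Type*} [NormedAddCommGroup H] [InnerProductSpace ℝ H] [CompleteSpace H]
  [RKHS ℝ H X ℝ] {lam : ℝ} (hlam : 0 < lam) {n : ℕ} (x : Fin n → X) (y : Fin n → ℝ)

theorem krrEstimator_le (h : H) :
    krrObjective lam x y (krrEstimator H hlam x y) ≤ krrObjective lam x y h :=
  (existsUnique_krr (H := H) hlam x y).choose_spec.1 h

/-- The normal equation of kernel ridge regression. -/
theorem krrEstimator_normal (h : H) :
    lam * ⟪krrEstimator H hlam x y, h⟫ + (n : ℝ)⁻¹ * ∑ i, krrEstimator H hlam x y (x i) * h (x i)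
      = (n : ℝ)⁻¹ * ∑ i, y i * h (x i) := by
  set g := krrEstimator H hlam x y with hg
  set a := lam * ⟪g, h⟫ + (n : ℝ)⁻¹ * ∑ i, g (x i) * h (x i) - (n : ℝ)⁻¹ * ∑ i, y i * h (x i)
    with ha
  set b := lam * ‖h‖ ^ 2 + (n : ℝ)⁻¹ * ∑ i, h (x i) ^ 2 with hb
  -- Minimality along the line `g + t • h`: a quadratic in `t` that is nonnegative and vanishes at 0
  -- has no linear term.
  have key : ∀ t : ℝ, 0 ≤ 2 * t * a + t ^ 2 * b := by
    intro t
    have h1 := krrEstimator_le hlam x y (g + t • h)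
    rw [← hg] at h1
    have e1 : ‖g + t • h‖ ^ 2 = ‖g‖ ^ 2 + 2 * t * ⟪g, h⟫ + t ^ 2 * ‖h‖ ^ 2 := by
      rw [norm_add_sq_real, inner_smul_right, norm_smul, mul_pow, Real.norm_eq_abs, sq_abs]
      ring
    have e2 : ∑ i, (y i - (g + t • h) (x i)) ^ 2 = ∑ i, (y i - g (x i)) ^ 2
        - 2 * t * ∑ i, y i * h (x i) + 2 * t * ∑ i, g (x i) * h (x i)
        + t ^ 2 * ∑ i, h (x i) ^ 2 := by
      simp only [Finset.mul_sum, ← Finset.sum_sub_distrib, ← Finset.sum_add_distrib]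
      refine Finset.sum_congr rfl fun i _ => ?_
      simp only [RKHS.coe_add, RKHS.coe_smul, Pi.add_apply, Pi.smul_apply, smul_eq_mul]
      ring
    unfold krrObjective at h1
    rw [e1, e2] at h1
    rw [ha, hb]
    linarith
  have hb0 : 0 ≤ b := by
    have : 0 ≤ ∑ i, h (x i) ^ 2 := Finset.sum_nonneg fun i _ => sq_nonneg _
    positivity
  have ha0 : a = 0 := by
    -- Dividing by `b + 1` instead of `b` covers the case `b = 0`.
    have h1 := key (-a / (b + 1))
    have h2 : 2 * (-a / (b + 1)) * a + (-a / (b + 1)) ^ 2 * b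
        = -(a ^ 2 * (b + 2) / (b + 1) ^ 2) := by
      field_simp
      ring
    rw [h2] at h1
    by_contra h3
    have : 0 < a ^ 2 * (b + 2) / (b + 1) ^ 2 := by positivity
    linarith
  linarith

variable (H) in
/-- The fitted values of kernel ridge regression with all responses equal to one. -/
def krrWeight (i : Fin n) : ℝ := krrEstimator H hlam x (fun _ => (1 : ℝ)) (x i)

/-- Test the normal equation for `y` with the fit to 1, and the one for 1 with the fit to `y`: the
left-hand sides agree by symmetry. -/
theorem sum_krrEstimator_eq :
    (n : ℝ)⁻¹ * ∑ i, krrEstimator H hlam x y (x i)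
      = (n : ℝ)⁻¹ * ∑ i, krrWeight H hlam x i * y i := by
  have h1 := krrEstimator_normal hlam x y (krrEstimator H hlam x (fun _ => (1 : ℝ)))
  have h2 := krrEstimator_normal hlam x (fun _ => (1 : ℝ)) (krrEstimator H hlam x y)
  simp only [one_mul] at h2
  rw [← h2, real_inner_comm]
  simp only [krrWeight]
  rw [Finset.sum_congr rfl fun i _ => mul_comm _ (y i), ← h1]
  congr 2
  exact Finset.sum_congr rfl fun i _ => mul_comm _ _

/-- Testing the normal equation with the fit itself and dropping the penalty gives `∑ g² ≤ ∑ g`;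
then `g ≤ (1 + g²)/2`. -/
theorem sum_krrWeight_sq_le : ∑ i, krrWeight H hlam x i ^ 2 ≤ n := by
  rcases Nat.eq_zero_or_pos n with rfl | hn
  · simp
  set g := krrEstimator H hlam x (fun _ => (1 : ℝ)) with hg
  have h1 := krrEstimator_normal hlam x (fun _ => (1 : ℝ)) g
  rw [← hg, real_inner_self_eq_norm_sq] at h1
  have hn' : (0 : ℝ) < n := by exact_mod_cast hn
  have h0 : 0 ≤ lam * ‖g‖ ^ 2 := by positivity
  have h2 : (n : ℝ)⁻¹ * ∑ i, g (x i) * g (x i) ≤ (n : ℝ)⁻¹ * ∑ i, 1 * g (x i) := by linarith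
  have h3 := le_of_mul_le_mul_left h2 (by positivity)
  have h4 : ∑ i, 1 * g (x i) ≤ ∑ i, ((1 + g (x i) * g (x i)) / 2) :=
    Finset.sum_le_sum fun i _ => by nlinarith [sq_nonneg (g (x i) - 1)]
  rw [← Finset.sum_div, Finset.sum_add_distrib] at h4
  simp only [Finset.sum_const, Finset.card_univ, Fintype.card_fin, nsmul_eq_mul] at h4
  simp only [krrWeight, sq, ← hg]
  linarith

/-- A crude bound, needed only for integrability of the weighted noise. -/
theorem abs_krrWeight_le (i : Fin n) : |krrWeight H hlam x i| ≤ √n := by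
  refine Real.abs_le_sqrt ((Finset.single_le_sum (f := fun i => krrWeight H hlam x i ^ 2)
    (fun i _ => sq_nonneg _) (Finset.mem_univ i)).trans (sum_krrWeight_sq_le hlam x))

/-- The constant 1 need not lie in `H`; the bound `√λ ‖g‖ ≤ 1` on its fit `g` is enough. -/
theorem abs_bias_le (f : H) :
    |(n : ℝ)⁻¹ * ∑ i, krrWeight H hlam x i * f (x i) - (n : ℝ)⁻¹ * ∑ i, f (x i)|
      ≤ √lam * ‖f‖ := by
  set g := krrEstimator H hlam x (fun _ => (1 : ℝ)) with hg
  have h1 := krrEstimator_normal hlam x (fun _ => (1 : ℝ)) f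
  simp only [one_mul] at h1
  have h2 : (n : ℝ)⁻¹ * ∑ i, krrWeight H hlam x i * f (x i) - (n : ℝ)⁻¹ * ∑ i, f (x i)
      = -(lam * ⟪g, f⟫) := by
    simp only [krrWeight]
    linarith
  rw [h2, abs_neg, abs_mul, abs_of_pos hlam]
  have h3 := krrEstimator_le hlam x (fun _ => (1 : ℝ)) (0 : H)
  rw [← hg] at h3
  have h4 : lam * ‖g‖ ^ 2 ≤ 1 := by
    have h5 : 0 ≤ (n : ℝ)⁻¹ * ∑ i, (1 - g (x i)) ^ 2 :=
      mul_nonneg (by positivity) (Finset.sum_nonneg fun i _ => sq_nonneg _)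
    -- An inequality, since the product is 0 when `n = 0`.
    have h6 : (n : ℝ)⁻¹ * n ≤ 1 := inv_mul_le_one
    simp only [krrObjective, RKHS.coe_zero, Pi.zero_apply, sub_zero, one_pow, Finset.sum_const,
      Finset.card_univ, Fintype.card_fin, nsmul_eq_mul, mul_one, norm_zero, ne_eq,
      OfNat.ofNat_ne_zero, not_false_eq_true, zero_pow, mul_zero, add_zero] at h3
    linarith
  have h7 : √lam * ‖g‖ ≤ 1 := by
    refine (sq_le_one_iff₀ (by positivity)).1 ?_
    rwa [mul_pow, Real.sq_sqrt hlam.le]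
  calc lam * |⟪g, f⟫| ≤ lam * (‖g‖ * ‖f‖) := by gcongr; exact abs_real_inner_le_norm _ _
    _ = √lam * ‖g‖ * (√lam * ‖f‖) := by
      nth_rw 1 [← Real.mul_self_sqrt hlam.le]
      ring
    _ ≤ 1 * (√lam * ‖f‖) := by gcongr
    _ = _ := one_mul _

open Matrix in
/-- The fitted values solve a linear system whose coefficients are kernel values. -/
theorem krrWeight_eq_inv_mulVec (hn : 0 < n) :
    krrWeight H hlam x = ((n * lam) • (1 : Matrix (Fin n) (Fin n) ℝ)
        + .of fun i j => RKHS.kernel H (x i) (x j) 1)⁻¹ *ᵥ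
      (fun i => ∑ j, RKHS.kernel H (x i) (x j) 1) := by
  set k : Fin n → H := fun i => RKHS.kerFun H (x i) (1 : ℝ) with hk
  have hin : ∀ i (g : H), ⟪k i, g⟫ = g (x i) := by
    intro i g
    simp [hk]
  have hkv : ∀ i j, k j (x i) = RKHS.kernel H (x i) (x j) 1 := by
    intro i j
    simp only [hk, RKHS.kerFun_apply]
  have hK : (Matrix.of fun i j => RKHS.kernel H (x i) (x j) 1 : Matrix (Fin n) (Fin n) ℝ)
      = gram ℝ k := by
    ext i j
    change _ = ⟪k i, k j⟫
    rw [hin]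
    exact (hkv i j).symm
  have hkx : ∀ i j, k i (x j) = RKHS.kernel H (x i) (x j) 1 := by
    intro i j
    rw [← hin, real_inner_comm, hin, hkv]
  have hn' : (0 : ℝ) < n := by exact_mod_cast hn
  set A := (n * lam) • (1 : Matrix (Fin n) (Fin n) ℝ)
        + .of fun i j => RKHS.kernel H (x i) (x j) 1 with hA
  -- A positive multiple of the identity plus a Gram matrix, hence invertible.
  have hpos : A.PosDef := by
    rw [hA, hK]
    exact (PosDef.one.smul (by positivity)).add_posSemidef (posSemidef_gram ℝ k)
  have hdet : IsUnit A.det := (isUnit_iff_isUnit_det A).1 hpos.isUnit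
  have hsys : A *ᵥ krrWeight H hlam x = fun i => ∑ j, RKHS.kernel H (x i) (x j) 1 := by
    ext i
    -- Row `i` of the system is the normal equation tested with the kernel section at `x i`.
    have h1 := krrEstimator_normal hlam x (fun _ => (1 : ℝ)) (k i)
    have h2 : ⟪krrEstimator H hlam x (fun _ => (1 : ℝ)), k i⟫ = krrWeight H hlam x i := by
      simp [hk, krrWeight]
    rw [h2] at h1
    simp only [one_mul, hkx] at h1
    rw [hA, add_mulVec, smul_mulVec, one_mulVec]
    simp only [Pi.add_apply, Pi.smul_apply, smul_eq_mul, mulVec, dotProduct, of_apply]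
    field_simp at h1
    rw [← h1]
    refine congrArg₂ _ (by ring) ?_
    exact Finset.sum_congr rfl fun j _ => mul_comm _ _
  rw [← hsys, mulVec_mulVec, nonsing_inv_mul _ hdet, one_mulVec]

end Deterministic

/-! ### Measurability of the kernel, of RKHS functions and of the weights. -/

section Measurability

/-- By Cramer's rule the entries are determinants times an inverse determinant. Singular matrices do
no harm, as inversion on `ℝ` with `0⁻¹ = 0` is measurable. -/
theorem measurable_matrix_inv {S : Type*} [MeasurableSpace S] {n : ℕ}
    {A : S → Matrix (Fin n) (Fin n) ℝ} (hA : ∀ i j, Measurable fun ω => A ω i j) (i j : Fin n) :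
    Measurable fun ω => (A ω)⁻¹ i j := by
  have hdet : ∀ {B : S → Matrix (Fin n) (Fin n) ℝ}, (∀ i j, Measurable fun ω => B ω i j) →
      Measurable fun ω => (B ω).det := by
    intro B hB
    simp only [Matrix.det_apply]
    exact Finset.measurable_sum _ fun τ _ =>
      (Finset.measurable_prod _ fun k _ => hB _ _).const_smul _
  simp only [Matrix.inv_def, Matrix.smul_apply, Ring.inverse_eq_inv', smul_eq_mul]
  refine (hdet hA).inv.mul ?_
  simp only [Matrix.adjugate_apply]
  refine hdet fun k l => ?_
  simp only [Matrix.updateRow_apply]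
  split_ifs
  · exact measurable_const
  · exact hA _ _

theorem measurable_besselK (ν : ℝ) : Measurable (besselK ν) := by
  have h : StronglyMeasurable (Function.uncurry fun z t : ℝ =>
      Real.exp (-z * Real.cosh t) * Real.cosh (ν * t)) := by
    refine Measurable.stronglyMeasurable ?_
    simp only [Function.uncurry_def]
    fun_prop
  exact (h.integral_prod_right (ν := volume.restrict (Set.Ioi (0 : ℝ)))).measurable

variable {d : ℕ}

theorem measurable_matern (ν ℓ : ℝ) :
    Measurable (matern ν ℓ : EuclideanSpace ℝ (Fin d) → ℝ) := by
  have h := measurable_besselK ν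
  unfold matern
  refine Measurable.ite (measurableSet_singleton 0) measurable_const ?_
  refine Measurable.mul (by fun_prop) (h.comp (by fun_prop))

variable {D : Set (EuclideanSpace ℝ (Fin d))} {ν ℓ : ℝ} [Fact (0 < ν)] [Fact (0 < ℓ)]

theorem kernel_maternRKHS (z z' : D) :
    RKHS.kernel (MaternRKHS D ν ℓ) z z' 1 = matern ν ℓ (z.1 - z'.1) := by
  rw [RKHS.OfKernel.kernel_ofKernel]
  simp [maternMatrix]

/-- Evaluation at `z` has norm `√k(z, z)`, and `k(z, z) = Ψ(0) = 1`. -/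
theorem abs_apply_le_norm (f : MaternRKHS D ν ℓ) (z : D) : |f z| ≤ ‖f‖ := by
  refine (RKHS.norm_apply_le f z).trans_eq ?_
  rw [RKHS.OfKernel.kernel_ofKernel]
  simp [maternMatrix, matern]

/-- Kernel sections are measurable and span a dense subspace, and norm convergence implies pointwise
convergence. -/
theorem measurable_coe_maternRKHS (f : MaternRKHS D ν ℓ) : Measurable (f : D → ℝ) := by
  have hspan : ∀ g ∈ Submodule.span ℝ
      {RKHS.kerFun (MaternRKHS D ν ℓ) z (v : ℝ) | (z : D) (v : ℝ)}, Measurable (g : D → ℝ) := by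
    intro g hg
    induction hg using Submodule.span_induction with
    | mem g hg =>
      obtain ⟨z, v, rfl⟩ := hg
      have : (RKHS.kerFun (MaternRKHS D ν ℓ) z v : D → ℝ)
          = fun z' => matern ν ℓ (z'.1 - z.1) * v := by
        ext z'
        rw [RKHS.kerFun_apply, ← kernel_maternRKHS (D := D)]
        rw [← mul_one v, ← smul_eq_mul, map_smul]
        simp [mul_comm]
      rw [this]
      exact ((measurable_matern ν ℓ).comp (by fun_prop)).mul_const v
    | zero => rw [RKHS.coe_zero]; exact measurable_zero
    | add g h _ _ hg hh => rw [RKHS.coe_add]; exact hg.add hh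
    | smul c g _ hg => rw [RKHS.coe_smul]; exact hg.const_smul c
  have hf : f ∈ closure ((Submodule.span ℝ
      {RKHS.kerFun (MaternRKHS D ν ℓ) z (v : ℝ) | (z : D) (v : ℝ)} : Submodule ℝ _) :
      Set (MaternRKHS D ν ℓ)) := by
    rw [← Submodule.topologicalClosure_coe, RKHS.kerFun_dense]
    trivial
  obtain ⟨u, hu, hlim⟩ := mem_closure_iff_seq_limit.1 hf
  refine measurable_of_tendsto_metrizable (fun k => hspan _ (hu k)) (tendsto_pi_nhds.2 fun z => ?_)
  exact ((RKHS.continuous_eval z).tendsto f).comp hlim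

/-- The σ-algebra on `S` is left free so that it can be the one generated by the scenarios. -/
theorem measurable_krrWeight {S : Type*} [MeasurableSpace S] {lam : ℝ} (hlam : 0 < lam) {n : ℕ}
    {x : Fin n → S → D} (hx : ∀ i, Measurable (x i)) (i : Fin n) :
    Measurable fun ω => krrWeight (MaternRKHS D ν ℓ) hlam (fun k => x k ω) i := by
  have hK : ∀ k l, Measurable fun ω =>
      RKHS.kernel (MaternRKHS D ν ℓ) (x k ω) (x l ω) 1 := by
    intro k l
    simp only [kernel_maternRKHS]
    exact (measurable_matern ν ℓ).comp
      ((measurable_subtype_coe.comp (hx k)).sub (measurable_subtype_coe.comp (hx l)))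
  simp only [krrWeight_eq_inv_mulVec hlam _ (Fin.pos i), Matrix.mulVec, dotProduct]
  refine Finset.measurable_sum _ fun j _ => Measurable.mul (measurable_matrix_inv ?_ _ _)
    (Finset.measurable_sum _ fun l _ => hK _ _)
  intro k l
  simp only [Matrix.add_apply, Matrix.of_apply]
  exact measurable_const.add (hK k l)

end Measurability

/-! ### Second-moment bounds, conditional and unconditional. -/

section Moments

variable {S : Type*} {m : MeasurableSpace S} [mS : MeasurableSpace S] {P : Measure S}

/-- Chebyshev's inequality in terms of the second moment. -/
theorem measureReal_le_abs_le {Z : S → ℝ} (hZ : MemLp Z 2 P) {a v : ℝ} (ha : 0 < a)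
    (hv : ∫ ω, Z ω ^ 2 ∂P ≤ v) : P.real {ω | a ≤ |Z ω|} ≤ v / a ^ 2 := by
  have h := mul_meas_ge_le_integral_of_nonneg (μ := P) (f := fun ω => Z ω ^ 2)
    (Eventually.of_forall fun ω => sq_nonneg _) hZ.integrable_sq (a ^ 2)
  have e : {ω | a ≤ |Z ω|} = {ω | a ^ 2 ≤ Z ω ^ 2} := by
    ext ω
    simp only [Set.mem_ofPred_eq]
    rw [← sq_abs (Z ω), sq_le_sq₀ ha.le (abs_nonneg _)]
  rw [e, le_div_iff₀ (by positivity), mul_comm]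
  exact h.trans hv

variable [IsProbabilityMeasure P]

/-- Second moment of a sum of conditionally centred, conditionally uncorrelated variables with
random weights that are known given the conditioning σ-algebra. -/
theorem integral_sq_weighted_sum_le {hm : m ≤ mS} {ι : Type*} [Fintype ι] {W X : ι → S → ℝ}
    {b c : ℝ} (hW : ∀ q, Measurable[m] (W q)) (hWb : ∀ q ω, |W q ω| ≤ b)
    (hX : ∀ q, MemLp (X q) 2 P)
    (hX2 : ∀ q, P[fun ω => X q ω ^ 2 | m] ≤ᵐ[P] fun _ => c)
    (hort : ∀ q q', q ≠ q' → P[fun ω => X q ω * X q' ω | m] =ᵐ[P] 0) :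
    MemLp (fun ω => ∑ q, W q ω * X q ω) 2 P ∧
      ∫ ω, (∑ q, W q ω * X q ω) ^ 2 ∂P ≤ c * ∫ ω, ∑ q, W q ω ^ 2 ∂P := by
  have hWX : ∀ q, MemLp (fun ω => W q ω * X q ω) 2 P := fun q =>
    (hX q).of_le_mul (((hW q).mono hm le_rfl).aestronglyMeasurable.mul (hX q).1)
      (Eventually.of_forall fun ω => by
        rw [norm_mul]
        exact mul_le_mul_of_nonneg_right (hWb q ω) (norm_nonneg _))
  refine ⟨memLp_finsetSum _ fun q _ => hWX q, ?_⟩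
  have hprod : ∀ q q', Integrable (fun ω => (W q ω * W q' ω) * (X q ω * X q' ω)) P := by
    intro q q'
    refine ((hWX q).integrable_mul (hWX q')).congr (Eventually.of_forall fun ω => ?_)
    simp only [Pi.mul_apply]
    ring
  have hWm : ∀ q q', StronglyMeasurable[m] fun ω => W q ω * W q' ω := fun q q' =>
    ((hW q).mul (hW q')).stronglyMeasurable
  -- Tower property, with the known weights pulled out of the conditional expectation.
  have hpull : ∀ q q', ∫ ω, (W q ω * W q' ω) * (X q ω * X q' ω) ∂P
      = ∫ ω, (W q ω * W q' ω) * (P[fun ω => X q ω * X q' ω | m]) ω ∂P := by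
    intro q q'
    rw [← integral_condExp hm]
    exact integral_congr_ae (condExp_mul_of_stronglyMeasurable_left (hWm q q') (hprod q q')
      ((hX q).integrable_mul (hX q')))
  have hoff : ∀ q q', q' ≠ q → ∫ ω, (W q ω * W q' ω) * (X q ω * X q' ω) ∂P = 0 := by
    intro q q' h
    rw [hpull, ← integral_zero S ℝ]
    refine integral_congr_ae ?_
    filter_upwards [hort q q' h.symm] with ω hω
    rw [hω]
    simp
  have hWsq : ∀ q, Integrable (fun ω => W q ω ^ 2) P := by
    intro q
    refine Integrable.of_bound (((hW q).mono hm le_rfl).pow_const 2).aestronglyMeasurable (b ^ 2)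
      (Eventually.of_forall fun ω => ?_)
    rw [Real.norm_of_nonneg (sq_nonneg _), ← sq_abs]
    exact pow_le_pow_left₀ (abs_nonneg _) (hWb q ω) 2
  have hdiag : ∀ q, ∫ ω, (W q ω * W q ω) * (X q ω * X q ω) ∂P ≤ c * ∫ ω, W q ω ^ 2 ∂P := by
    intro q
    rw [hpull, ← integral_const_mul]
    refine integral_mono_ae ?_ ((hWsq q).const_mul c) ?_
    · refine (integrable_condExp (m := m) (f := fun ω => (W q ω * W q ω) * (X q ω * X q ω))).congr
        (condExp_mul_of_stronglyMeasurable_left (hWm q q) (hprod q q)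
          ((hX q).integrable_mul (hX q)))
    · filter_upwards [hX2 q] with ω hω
      simp only [← sq] at hω ⊢
      rw [mul_comm c]
      gcongr
  have hexp : ∀ ω, (∑ q, W q ω * X q ω) ^ 2
      = ∑ q, ∑ q', (W q ω * W q' ω) * (X q ω * X q' ω) := by
    intro ω
    rw [sq, Finset.sum_mul_sum]
    exact Finset.sum_congr rfl fun q _ => Finset.sum_congr rfl fun q' _ => by ring
  simp only [hexp]
  rw [integral_finsetSum _ fun q _ => integrable_finsetSum _ fun q' _ => hprod q q',
    integral_finsetSum _ fun q _ => hWsq q, Finset.mul_sum]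
  refine Finset.sum_le_sum fun q _ => ?_
  rw [integral_finsetSum _ fun q' _ => hprod q q',
    Finset.sum_eq_single q (fun q' _ h => hoff q q' h) (by simp)]
  exact hdiag q

/-- The mean squared error of the average of independent copies of a bounded variable. -/
theorem integral_sq_average_sub_le {X : Type*} [MeasurableSpace X] {μX : Measure X}
    [IsProbabilityMeasure μX] {n : ℕ} (hn : 0 < n) {x : Fin n → S → X}
    (hx : ∀ i, Measurable (x i)) (hmap : ∀ i, P.map (x i) = μX) (hind : iIndepFun x P)
    {f : X → ℝ} (hf : Measurable f) {b : ℝ} (hb : ∀ z, |f z| ≤ b) :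
    MemLp (fun ω => (n : ℝ)⁻¹ * ∑ i, f (x i ω) - ∫ z, f z ∂μX) 2 P ∧
      ∫ ω, ((n : ℝ)⁻¹ * ∑ i, f (x i ω) - ∫ z, f z ∂μX) ^ 2 ∂P ≤ b ^ 2 / n := by
  have hL : ∀ i, MemLp (fun ω => f (x i ω)) 2 P := fun i =>
    MemLp.of_bound (hf.comp (hx i)).aestronglyMeasurable b (Eventually.of_forall fun ω => hb _)
  have hS : MemLp (fun ω => ∑ i, f (x i ω)) 2 P := memLp_finsetSum _ fun i _ => hL i
  have hA : MemLp (fun ω => (n : ℝ)⁻¹ * ∑ i, f (x i ω)) 2 P := hS.const_mul _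
  have hn' : (0 : ℝ) < n := by exact_mod_cast hn
  have hmean : ∫ ω, (n : ℝ)⁻¹ * ∑ i, f (x i ω) ∂P = ∫ z, f z ∂μX := by
    rw [integral_const_mul, integral_finsetSum _ fun i _ => (hL i).integrable one_le_two]
    have : ∀ i, ∫ ω, f (x i ω) ∂P = ∫ z, f z ∂μX := by
      intro i
      rw [← hmap i, integral_map (hx i).aemeasurable hf.aestronglyMeasurable]
    simp only [this, Finset.sum_const, Finset.card_univ, Fintype.card_fin, nsmul_eq_mul]
    field_simp
  refine ⟨hA.sub (memLp_const _), ?_⟩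
  rw [← hmean, ← variance_eq_integral hA.aemeasurable, variance_const_mul]
  have hvar : Var[fun ω => ∑ i, f (x i ω); P] = ∑ i, Var[fun ω => f (x i ω); P] := by
    have h := IndepFun.variance_sum (μ := P) (X := fun i ω => f (x i ω)) (s := Finset.univ)
      (fun i _ => hL i)
      (fun i _ j _ hij => (hind.indepFun hij).comp hf hf)
    rw [← h]
    congr 1
    ext ω
    simp
  have hle : ∀ i, Var[fun ω => f (x i ω); P] ≤ b ^ 2 := by
    intro i
    refine (variance_le_expectation_sq (hL i).aestronglyMeasurable).trans ?_
    refine (integral_mono (hL i).integrable_sq (integrable_const (b ^ 2)) fun ω => ?_).trans_eq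
      (by simp)
    beta_reduce
    rw [← sq_abs]
    exact pow_le_pow_left₀ (abs_nonneg _) (hb _) 2
  rw [hvar]
  calc ((n : ℝ)⁻¹) ^ 2 * ∑ i, Var[fun ω => f (x i ω); P]
      ≤ ((n : ℝ)⁻¹) ^ 2 * ∑ _i : Fin n, b ^ 2 := by
        gcongr
        exact hle _
    _ = b ^ 2 / n := by
        simp
        field_simp

variable [StandardBorelSpace S]

/-- The right-hand side involves only the exponential moments at `±1`, which the sub-Gaussian
condition controls. -/
theorem sq_le_exp_add_exp_neg (u : ℝ) : u ^ 2 ≤ 2 * (Real.exp (1 * u) + Real.exp (-1 * u)) := by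
  have h1 := Real.quadratic_le_exp_of_nonneg (abs_nonneg u)
  rw [sq_abs] at h1
  have h2 : Real.exp |u| ≤ Real.exp (1 * u) + Real.exp (-1 * u) := by
    rcases abs_choice u with h | h <;> rw [h]
    · rw [one_mul]; linarith [Real.exp_pos (-1 * u)]
    · rw [neg_one_mul]; linarith [Real.exp_pos (1 * u)]
  linarith [abs_nonneg u]

theorem _root_.ProbabilityTheory.HasCondSubgaussianMGF.memLp_two {hm : m ≤ mS} {X : S → ℝ}
    {c : ℝ≥0} (h : HasCondSubgaussianMGF m hm X c P) (hX : Measurable X) : MemLp X 2 P := by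
  rw [memLp_two_iff_integrable_sq hX.aestronglyMeasurable]
  refine Integrable.mono' (((h.integrable_exp_mul 1).add (h.integrable_exp_mul (-1))).const_mul 2)
    (by fun_prop) (Eventually.of_forall fun ω => ?_)
  rw [Real.norm_of_nonneg (sq_nonneg _)]
  exact sq_le_exp_add_exp_neg (X ω)

/-- The constant is not sharp; what matters is that it depends on the variance proxy alone. -/
theorem _root_.ProbabilityTheory.HasCondSubgaussianMGF.condExp_sq_le {hm : m ≤ mS} {X : S → ℝ}
    {c : ℝ≥0} (h : HasCondSubgaussianMGF m hm X c P) (hX : Measurable X) :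
    P[fun ω => X ω ^ 2 | m] ≤ᵐ[P] fun _ => 4 * Real.exp (c / 2) := by
  have hi := h.integrable_exp_mul 1
  have hi' := h.integrable_exp_mul (-1)
  have h1 := condExp_mono (m := m) (h.memLp_two hX).integrable_sq ((hi.add hi').const_mul 2)
    (Eventually.of_forall fun ω => sq_le_exp_add_exp_neg (X ω))
  have h2 := condExp_smul (μ := P) (2 : ℝ)
    ((fun ω => Real.exp (1 * X ω)) + fun ω => Real.exp (-1 * X ω)) m
  have h3 := condExp_add hi hi' m
  filter_upwards [h1, h2, h3, h.ae_condExp_le 1, h.ae_condExp_le (-1)] with ω g1 g2 g3 g4 g5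
  refine g1.trans ?_
  have g6 : (P[fun ω => 2 * (Real.exp (1 * X ω) + Real.exp (-1 * X ω)) | m]) ω
      = 2 * ((P[fun ω => Real.exp (1 * X ω) | m]) ω + (P[fun ω => Real.exp (-1 * X ω) | m]) ω) := by
    rw [Pi.add_apply] at g3
    rw [← g3]
    exact g2
  refine (le_of_eq g6).trans ?_
  norm_num at g4 g5 ⊢
  linarith

/-- Conditionally independent variables with conditional mean zero are conditionally
uncorrelated. -/
theorem condExp_mul_eq_zero_of_condIndepFun {hm : m ≤ mS} {X Y : S → ℝ} (hX : Measurable X)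
    (hY : Measurable Y) (hXi : MemLp X 2 P) (hYi : MemLp Y 2 P)
    (hind : CondIndepFun m hm X Y P) (hX0 : P[X | m] =ᵐ[P] 0) :
    P[fun ω => X ω * Y ω | m] =ᵐ[P] 0 := by
  have h1 := (condIndepFun_iff_map_prod_eq_prod_map_map hX hY).1 hind
  have h2 := condExp_ae_eq_integral_condExpKernel hm (hXi.integrable_mul hYi)
  have h3 := condExp_ae_eq_integral_condExpKernel hm (hXi.integrable one_le_two)
  filter_upwards [ae_of_ae_trim hm h1, h2, h3, hX0] with ω g1 g2 g3 g4
  refine g2.trans ?_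
  have hXY : Measurable fun ω => (X ω, Y ω) := hX.prodMk hY
  rw [Kernel.prod_apply, Kernel.map_apply _ hXY, Kernel.map_apply _ hX, Kernel.map_apply _ hY] at g1
  -- For almost every `ω`, conditional independence is ordinary independence under the conditional
  -- law.
  have hI : IndepFun X Y (condExpKernel P m ω) :=
    (indepFun_iff_map_prod_eq_prod_map_map hX.aemeasurable hY.aemeasurable).2 g1
  have := hI.integral_mul_eq_mul_integral (hX.mono le_rfl le_rfl).aestronglyMeasurable hY.aestronglyMeasurable
  refine this.trans ?_
  rw [← g3, g4, Pi.zero_apply, zero_mul]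

end Moments

/-! ### Error of the nested estimator for finite `n` and `m`. -/

section NestedSimulation

variable {d : ℕ} {D : Set (EuclideanSpace ℝ (Fin d))} {ν ℓ : ℝ} [Fact (0 < ν)] [Fact (0 < ℓ)]
  {S : Type*} [MeasurableSpace S] [StandardBorelSpace S] {P : Measure S} [IsProbabilityMeasure P]
  {μX : Measure D} {σ : ℝ≥0} {n m : ℕ} {x : Fin n → S → D} {ε : Fin n → Fin m → S → ℝ}

/-- The contribution of the simulation noise to the nested estimator. -/
theorem integral_sq_weighted_noise_le (h : IsNestedSample P μX σ x ε) {lam : ℝ} (hlam : 0 < lam)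
    (hn : 0 < n) (hm : 0 < m) :
    MemLp (fun ω => (n : ℝ)⁻¹ * ∑ i, krrWeight (MaternRKHS D ν ℓ) hlam (fun k => x k ω) i *
        innerMean (fun i j => ε i j ω) i) 2 P ∧
      ∫ ω, ((n : ℝ)⁻¹ * ∑ i, krrWeight (MaternRKHS D ν ℓ) hlam (fun k => x k ω) i *
        innerMean (fun i j => ε i j ω) i) ^ 2 ∂P
      ≤ 4 * Real.exp ((σ : ℝ) ^ 2 / 2) / (n * m) := by
  have hle := scenarioSigma_le h.measurable_scenario
  set W : Fin n × Fin m → S → ℝ := fun q ω =>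
    krrWeight (MaternRKHS D ν ℓ) hlam (fun k => x k ω) q.1 with hW
  set E : Fin n × Fin m → S → ℝ := fun q => ε q.1 q.2 with hE
  have hWm : ∀ q, Measurable[scenarioSigma x] (W q) := by
    intro q
    refine @measurable_krrWeight d D ν ℓ _ _ S (scenarioSigma x) lam hlam n x (fun i => ?_) q.1
    exact (measurable_pi_apply i).comp (comap_measurable fun ω i => x i ω)
  have hEm : ∀ q, Measurable (E q) := fun q => h.measurable_noise q.1 q.2
  have hE2 : ∀ q, MemLp (E q) 2 P := fun q => (h.subgaussian_noise q.1 q.2).memLp_two (hEm q)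
  obtain ⟨h1, h2⟩ := integral_sq_weighted_sum_le (hm := hle) (W := W) (X := E) (b := √n)
    (c := 4 * Real.exp ((σ : ℝ) ^ 2 / 2)) hWm
    (fun q ω => abs_krrWeight_le hlam _ _) hE2
    (fun q => by
      have := (h.subgaussian_noise q.1 q.2).condExp_sq_le (hEm q)
      simpa using this)
    (fun q q' hq => condExp_mul_eq_zero_of_condIndepFun (hEm q) (hEm q') (hE2 q) (hE2 q')
      (h.indep_noise.condIndepFun hq) (h.mean_noise q.1 q.2))
  have hn' : (0 : ℝ) < n := by exact_mod_cast hn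
  have hm' : (0 : ℝ) < m := by exact_mod_cast hm
  have hrw : ∀ ω, (n : ℝ)⁻¹ * ∑ i, krrWeight (MaternRKHS D ν ℓ) hlam (fun k => x k ω) i *
      innerMean (fun i j => ε i j ω) i = ((n : ℝ) * m)⁻¹ * ∑ q, W q ω * E q ω := by
    intro ω
    simp only [Fintype.sum_prod_type, innerMean, hW, hE, Finset.mul_sum]
    refine Finset.sum_congr rfl fun i _ => Finset.sum_congr rfl fun j _ => ?_
    rw [mul_inv]
    ring
  -- The bound is pointwise: each scenario weight occurs `m` times.
  have hWsum : ∫ ω, ∑ q, W q ω ^ 2 ∂P ≤ n * m := by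
    refine (integral_mono_of_nonneg (Eventually.of_forall fun ω =>
      Finset.sum_nonneg fun q _ => sq_nonneg _) (integrable_const ((n : ℝ) * m))
      (Eventually.of_forall fun ω => ?_)).trans_eq (by simp)
    have := sum_krrWeight_sq_le (H := MaternRKHS D ν ℓ) hlam (fun k => x k ω)
    simp only [Fintype.sum_prod_type, hW, Finset.sum_const, Finset.card_univ, Fintype.card_fin,
      nsmul_eq_mul, ← Finset.mul_sum]
    rw [mul_comm (n : ℝ)]
    gcongr
  simp only [hrw]
  refine ⟨h1.const_mul _, ?_⟩
  simp only [mul_pow]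
  rw [integral_const_mul]
  calc ((n : ℝ) * m)⁻¹ ^ 2 * ∫ ω, (∑ q, W q ω * E q ω) ^ 2 ∂P
      ≤ ((n : ℝ) * m)⁻¹ ^ 2 * (4 * Real.exp ((σ : ℝ) ^ 2 / 2) * (n * m)) := by
        gcongr
        exact h2.trans (by gcongr)
    _ = _ := by field_simp

/-- Splitting of the error of the nested estimator into bias, noise and sampling error. -/
theorem abs_krrNestedMean_sub_le {lam : ℝ} (hlam : 0 < lam) (f : MaternRKHS D ν ℓ)
    (z : Fin n → D) (e : Fin n → Fin m → ℝ) (hm : 0 < m) (θ : ℝ) :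
    |krrNestedMean (MaternRKHS D ν ℓ) hlam z (fun i j => f (z i) + e i j) - θ|
      ≤ √lam * ‖f‖
        + |(n : ℝ)⁻¹ * ∑ i, krrWeight (MaternRKHS D ν ℓ) hlam z i * innerMean e i|
        + |(n : ℝ)⁻¹ * ∑ i, f (z i) - θ| := by
  have hm' : (m : ℝ) ≠ 0 := by exact_mod_cast hm.ne'
  have hy : innerMean (fun i j => f (z i) + e i j) = fun i => f (z i) + innerMean e i := by
    ext i
    simp only [innerMean, Finset.sum_add_distrib, Finset.sum_const, Finset.card_univ,
      Fintype.card_fin, nsmul_eq_mul]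
    field_simp
  rw [krrNestedMean, sum_krrEstimator_eq, hy]
  simp only [mul_add, Finset.sum_add_distrib]
  have h1 := abs_bias_le hlam z f
  refine le_trans (le_of_eq ?_) ((abs_add_three _ _ _).trans (by gcongr))
  congr 1
  ring

/-- A non-asymptotic tail bound for the nested estimator. -/
theorem measureReal_lt_abs_krrNestedMean_sub_le [IsProbabilityMeasure μX]
    (h : IsNestedSample P μX σ x ε) {lam : ℝ} (hlam : 0 < lam) (hn : 0 < n) (hm : 0 < m)
    (f : MaternRKHS D ν ℓ) {a : ℝ} (ha : 0 < a) :
    P.real {ω | √lam * ‖f‖ + 2 * a < |krrNestedMean (MaternRKHS D ν ℓ) hlam (fun i => x i ω)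
        (fun i j => f (x i ω) + ε i j ω) - ∫ z, f z ∂μX|}
      ≤ 4 * Real.exp ((σ : ℝ) ^ 2 / 2) / (n * m) / a ^ 2 + ‖f‖ ^ 2 / n / a ^ 2 := by
  obtain ⟨h1, h2⟩ := integral_sq_weighted_noise_le (ν := ν) (ℓ := ℓ) h hlam hn hm
  obtain ⟨h3, h4⟩ := integral_sq_average_sub_le hn h.measurable_scenario h.map_scenario
    h.indep_scenario (measurable_coe_maternRKHS f) (abs_apply_le_norm f)
  refine le_trans ?_ (add_le_add (measureReal_le_abs_le h1 ha h2) (measureReal_le_abs_le h3 ha h4))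
  refine le_trans (measureReal_mono ?_) (measureReal_union_le _ _)
  intro ω hω
  have h5 := abs_krrNestedMean_sub_le hlam f (fun i => x i ω) (fun i j => ε i j ω) hm
    (∫ z, f z ∂μX)
  have hω := lt_of_lt_of_le hω h5
  -- If both random terms were below `a`, the error could not exceed the bias bound plus `2 * a`.
  by_contra hc
  simp only [Set.mem_union, Set.mem_ofPred_eq, not_or, not_le] at hc
  linarith [hc.1, hc.2]

end NestedSimulation

end

end NestedKRR


/-! ### The rate in the simulation budget. -/

open NestedKRR
theorem corollary1 {d : ℕ} {D : Set (EuclideanSpace ℝ (Fin d))}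
    (hDbdd : Bornology.IsBounded D) (hDconv : Convex ℝ D)
    (μX : Measure D) [IsProbabilityMeasure μX] (hμX : HasDensityBoundedAboveBelow μX)
    (ν ℓ : ℝ) [Fact (0 < ν)] [Fact (0 < ℓ)]
    (f : D → ℝ) (hf : f ∈ Set.range fun g : MaternRKHS D ν ℓ => (⇑g : D → ℝ))
    (σ : ℝ≥0) (n m : ℕ → ℕ) (Γ lam : ℕ → ℝ)
    (hΓ : ∀ t, Γ t = n t * m t) (hΓlim : Tendsto Γ atTop atTop)
    (hn : (fun t => (n t : ℝ)) =Θ[atTop] Γ)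
    (hm : (fun t => (m t : ℝ)) =Θ[atTop] fun _ => (1 : ℝ))
    (hlam : ∀ t, 0 < lam t) (hlamΓ : lam =Θ[atTop] fun t => (Γ t)⁻¹)
    {S : ℕ → Type*} [∀ t, MeasurableSpace (S t)] [∀ t, StandardBorelSpace (S t)]
    (P : ∀ t, Measure (S t)) [∀ t, IsProbabilityMeasure (P t)]
    (x : ∀ t, Fin (n t) → S t → D) (ε : ∀ t, Fin (n t) → Fin (m t) → S t → ℝ)
    (hsample : ∀ t, IsNestedSample (P t) μX σ (x t) (ε t)) :
    Integrable f μX ∧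
      IsBigOInProb P
        (fun t ω =>
          |krrNestedMean (MaternRKHS D ν ℓ) (hlam t) (fun i => x t i ω)
              (fun i j => f (x t i ω) + ε t i j ω) - ∫ z, f z ∂μX|)
        (fun t => Γ t ^ (-(1 / 2) : ℝ)) := by
  obtain ⟨g, rfl⟩ := hf
  refine ⟨Integrable.of_bound (measurable_coe_maternRKHS g).aestronglyMeasurable ‖g‖
    (Eventually.of_forall fun z => abs_apply_le_norm g z), fun δ hδ => ?_⟩
  -- The constants give `Γ ≤ a n` and `λ ≤ b Γ⁻¹` eventually.
  obtain ⟨a, ha, hna⟩ := hn.2.exists_pos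
  obtain ⟨b, hb, hlb⟩ := hlamΓ.1.exists_pos
  -- `K / Γ` bounds the sum of the two second moments; `c` is chosen so that Chebyshev's bound at
  -- level `c Γ^(-1/2)` is `K / c² = δ / 2`.
  set K : ℝ := 4 * Real.exp ((σ : ℝ) ^ 2 / 2) + ‖g‖ ^ 2 * a with hK
  have hK0 : 0 < K := by positivity
  set c : ℝ := √(2 * K / δ) with hc
  have hc0 : 0 < c := by positivity
  refine ⟨√b * ‖g‖ + 2 * c, by positivity, ?_⟩
  filter_upwards [hna.bound, hlb.bound, hΓlim.eventually_gt_atTop 0] with t h1 h2 h3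
  have hnm : 0 < (n t : ℝ) * m t := hΓ t ▸ h3
  have hn0 : 0 < n t := Nat.pos_of_ne_zero fun h0 => by simp [h0] at hnm
  have hm0 : 0 < m t := Nat.pos_of_ne_zero fun h0 => by simp [h0] at hnm
  rw [Real.norm_of_nonneg h3.le, Real.norm_of_nonneg (Nat.cast_nonneg _)] at h1
  rw [Real.norm_of_nonneg (hlam t).le, Real.norm_of_nonneg (inv_nonneg.2 h3.le)] at h2
  have hn' : (0 : ℝ) < n t := by exact_mod_cast hn0
  set r : ℝ := Γ t ^ (-(1 / 2) : ℝ) with hr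
  have hr0 : 0 < r := Real.rpow_pos_of_pos h3 _
  have hr2 : r ^ 2 = (Γ t)⁻¹ := by
    rw [hr, ← Real.rpow_natCast, ← Real.rpow_mul h3.le, ← Real.rpow_neg_one]
    norm_num
  have hlamr : √(lam t) ≤ √b * r := by
    rw [← Real.sqrt_sq hr0.le, ← Real.sqrt_mul hb.le, hr2]
    exact Real.sqrt_le_sqrt h2
  have h4 := measureReal_lt_abs_krrNestedMean_sub_le (hsample t) (hlam t) hn0 hm0 g
    (mul_pos hc0 hr0)
  refine lt_of_le_of_lt (measureReal_mono fun ω hω => ?_) (lt_of_le_of_lt h4 ?_)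
  · rw [Set.mem_ofPred_eq] at hω ⊢
    refine lt_of_le_of_lt ?_ hω
    have : √(lam t) * ‖g‖ ≤ √b * r * ‖g‖ := by gcongr
    linarith
  · have hcr : (c * r) ^ 2 = 2 * K / δ / Γ t := by
      rw [mul_pow, hr2, hc, Real.sq_sqrt (by positivity)]
      rfl
    have h5 : ‖g‖ ^ 2 / n t ≤ ‖g‖ ^ 2 * a / Γ t := by
      rw [div_le_div_iff₀ hn' h3, mul_assoc]
      gcongr
    rw [← hΓ t, ← add_div, hcr]
    calc _ ≤ (4 * Real.exp ((σ : ℝ) ^ 2 / 2) / Γ t + ‖g‖ ^ 2 * a / Γ t) / (2 * K / δ / Γ t) := by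
          gcongr
      _ = δ / 2 := by
          rw [← add_div, ← hK]
          field_simp
      _ < δ := by linarith
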